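/- Conventions. Manifolds are smooth (Hausdorff, second countable) of dimension $n+1\ge 2$. A *continuous* (resp. *smooth*) spacetime is such a manifold with a Lorentzian metric of signature $(-,+,\dots,+)$ whose components in all coordinates are continuous (resp. smooth), together with a time orientation given by a continuous timelike vector field. A *future directed causal curve* is a Lipschitz curve $\gamma\colon[a,b]\to M$, $a<b$, such that $\gamma'$ is (nonzero) future directed causal almost everywhere; it is *timelike* if in addition $g(\gamma',\gamma')<-\varepsilon$ almost everywhere for some $\varepsilon>0$. $I^+(x,M)$ is the set of endpoints $\gamma(b)$ of future directed timelike curves in $M$ with $\gamma(a)=x$. A continuous spacetime $(M_{\rm ext},g_{\rm ext})$ is a *continuous extension* of a smooth spacetime $(M,g)$ of the same dimension if there is a smooth isometric embedding $M\hookrightarrow M_{\rm ext}$ that preserves time orientations and whose image is a proper subset; $M$ is identified with its image. The *past boundary* $\partial^-M$ is the set of points $x\in\overline M\setminus M$ for which there is a future directed timelike curve $\gamma\colon[a,b]\to M_{\rm ext}$ with $\gamma(a)=x$ and $\gamma((a,b])\subset M$. A function on $M$ *extends continuously* to $M\cup\{\mathcal O\}$ if it is the restriction of a continuous function on the subspace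 $M\cup\{\mathcal O\}$ of $M_{\rm ext}$; a tensor on $M$ extends continuously to $M\cup\{\mathcal O\}$ if, in some coordinate neighborhood $U\subset M_{\rm ext}$ of $\mathcal O$, each of its components extends continuously from $U\cap M$ to $(U\cap M)\cup\{\mathcal O\}$. $(M_{\rm ext},g_{\rm ext})$ is *strongly causal at* $\mathcal O$ if for every neighborhood $U$ of $\mathcal O$ there is a neighborhood $V\subset U$ of $\mathcal O$ such that every future directed causal curve in $M_{\rm ext}$ with both endpoints in $V$ is contained in $U$. Theorem. Let $(M_{\rm ext},g_{\rm ext})$ be a continuous extension of a smooth spacetime $(M,g)$ of dimension $n+1\ge2$ such that $M=I^+(\mathcal O,M_{\rm ext})$ for some point $\mathcal O\in\partial^-M$. Assume: (a) $(M,g)$ solves the Einstein equations with a perfect fluid $(u,\rho,p)$: $u$ is a smooth future directed timelike vector field on $M$ with $g(u,u)=-1$, $\rho$ and $p$ are smooth functions on $M$, and $$\mathrm{Ric}-\tfrac12 R\,g=8\pi\big[(\rho+p)\,u_*\otimes u_*+p\,g\big],\qquad u_*=g(u,\cdot).$$ (b) All integral curves of $u$ have past endpoint $\mathcal O$ within $M_{\rm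 ext}$, and the extended curves are future directed timelike on compact domains. That is, every integral curve $(\alpha,b]\to M$ of $u$ continues to the past to an integral curve $\gamma\colon(a,b]\to M$ of $u$, with $a\le\alpha$ real, such that setting $\gamma(a)=\mathcal O$ makes $\gamma\colon[a,b]\to M_{\rm ext}$ a future directed timelike curve. (c) The Ricci tensor $\mathrm{Ric}$ of $(M,g)$, $\rho$ and $p$ extend continuously to $M\cup\{\mathcal O\}$. (d) $(M_{\rm ext},g_{\rm ext})$ is strongly causal at $\mathcal O$. Then the continuous extensions $\tilde\rho,\tilde p$ of $\rho,p$ satisfy $\tilde\rho(\mathcal O)=-\tilde p(\mathcal O)$. -/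

import Mathlib

open scoped Manifold ContDiff Topology
open Set MeasureTheory

noncomputable section

namespace Spacetimes

/-- The model space `ℝ^{n+1}` of `(n+1)`-dimensional manifolds; coordinates are
`x^0, …, x^n`. -/
abbrev Model (n : ℕ) : Type := EuclideanSpace ℝ (Fin (n + 1))

section Coordinates

variable {n : ℕ} {M : Type*} [TopologicalSpace M] [ChartedSpace (Model n) M]

/-- The coordinate vector `∂_i`, in the coordinates `e`, at the point with coordinates `y`. -/
def coordVec (e : OpenPartialHomeomorph M (Model n)) (y : Model n) (i : Fin (n + 1)) :
    TangentSpace (𝓡 (n + 1)) (e.symm y) :=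
  mfderiv (𝓡 (n + 1)) (𝓡 (n + 1)) e.symm y (EuclideanSpace.single i (1 : ℝ) : Model n)

/-- `dx^i(v)`: the `i`-th component of the tangent vector `v` in the coordinates `e`. -/
def coordForm (e : OpenPartialHomeomorph M (Model n)) (x : M)
    (v : TangentSpace (𝓡 (n + 1)) x) (i : Fin (n + 1)) : ℝ :=
  (show Model n from mfderiv (𝓡 (n + 1)) (𝓡 (n + 1)) e x v) i

/-- The matrix `g_{ij} = g(∂_i, ∂_j)` of a field of bilinear forms in the coordinates `e`, as a
function of the coordinates `y`. -/
def metricComp (g : ∀ x : M, LinearMap.BilinForm ℝ (TangentSpace (𝓡 (n + 1)) x))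
    (e : OpenPartialHomeomorph M (Model n)) (y : Model n) :
    Matrix (Fin (n + 1)) (Fin (n + 1)) ℝ :=
  Matrix.of fun i j => g (e.symm y) (coordVec e y i) (coordVec e y j)

/-- The partial derivative `∂f/∂x^k` on `ℝ^{n+1}`. -/
def partialDeriv (k : Fin (n + 1)) (f : Model n → ℝ) (y : Model n) : ℝ :=
  fderiv ℝ f y (EuclideanSpace.single k (1 : ℝ))

/-- The Christoffel symbols
`Γ^k_{ij} = ½ ∑_l g^{kl} (∂_i g_{jl} + ∂_j g_{il} - ∂_l g_{ij})` in the coordinates `e`. -/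
def christoffel (g : ∀ x : M, LinearMap.BilinForm ℝ (TangentSpace (𝓡 (n + 1)) x))
    (e : OpenPartialHomeomorph M (Model n)) (k i j : Fin (n + 1)) (y : Model n) : ℝ :=
  (1 / 2) * ∑ l, (metricComp g e y)⁻¹ k l *
    (partialDeriv i (fun z => metricComp g e z j l) y
      + partialDeriv j (fun z => metricComp g e z i l) y
      - partialDeriv l (fun z => metricComp g e z i j) y)

/-- The components of the Ricci tensor in the coordinates `e`:
`R_{ij} = ∂_k Γ^k_{ij} - ∂_j Γ^k_{ki} + Γ^k_{kl} Γ^l_{ij} - Γ^k_{jl} Γ^l_{ik}`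
(summation over `k` and `l`). -/
def ricciComp (g : ∀ x : M, LinearMap.BilinForm ℝ (TangentSpace (𝓡 (n + 1)) x))
    (e : OpenPartialHomeomorph M (Model n)) (y : Model n) :
    Matrix (Fin (n + 1)) (Fin (n + 1)) ℝ :=
  Matrix.of fun i j =>
    ∑ k, (partialDeriv k (christoffel g e k i j) y - partialDeriv j (christoffel g e k k i) y)
      + ∑ k, ∑ l, (christoffel g e k k l y * christoffel g e l i j y
          - christoffel g e k j l y * christoffel g e l i k y)

/-- The Ricci tensor `Ric = ∑ R_{ij} dx^i ⊗ dx^j` at `x`, computed in the preferred chart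
at `x` (for a smooth metric the result is the same in all charts). -/
def ricci (g : ∀ x : M, LinearMap.BilinForm ℝ (TangentSpace (𝓡 (n + 1)) x)) (x : M)
    (v w : TangentSpace (𝓡 (n + 1)) x) : ℝ :=
  ∑ i, ∑ j, ricciComp g (chartAt (Model n) x) (chartAt (Model n) x x) i j
    * coordForm (chartAt (Model n) x) x v i * coordForm (chartAt (Model n) x) x w j

/-- The scalar curvature `R = ∑ g^{ij} R_{ij}` at `x`. -/
def scalarCurvature (g : ∀ x : M, LinearMap.BilinForm ℝ (TangentSpace (𝓡 (n + 1)) x))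
    (x : M) : ℝ :=
  ∑ i, ∑ j, (metricComp g (chartAt (Model n) x) (chartAt (Model n) x x))⁻¹ i j
    * ricciComp g (chartAt (Model n) x) (chartAt (Model n) x x) i j

end Coordinates

/-- A symmetric bilinear form of signature `(-, +, …, +)`. -/
def IsLorentzian {n : ℕ} {V : Type*} [AddCommGroup V] [Module ℝ V]
    (B : LinearMap.BilinForm ℝ V) : Prop :=
  ∃ b : Module.Basis (Fin (n + 1)) ℝ V,
    ∀ i j, B (b i) (b j) = if i = j then (if i = 0 then -1 else 1) else 0

/-- A spacetime of dimension `n + 1` with a metric of class `C^k` (`k = 0`: continuous spacetime,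
`k = ∞`: smooth spacetime): a time-oriented Lorentzian metric on the smooth manifold `M`. The
regularity of the metric is that of its components in all coordinate systems; the
time orientation is given by a continuous timelike vector field. -/
structure Spacetime (n : ℕ) (k : WithTop ℕ∞) (M : Type*) [TopologicalSpace M]
    [ChartedSpace (Model n) M] [IsManifold (𝓡 (n + 1)) ∞ M] where
  /-- the metric -/
  metric : ∀ x : M, LinearMap.BilinForm ℝ (TangentSpace (𝓡 (n + 1)) x)
  isLorentzian : ∀ x, IsLorentzian (n := n) (metric x)
  contDiffOn : ∀ e ∈ IsManifold.maximalAtlas (𝓡 (n + 1)) ∞ M, ∀ i j,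
    ContDiffOn ℝ k (fun y => metricComp metric e y i j) e.target
  /-- the vector field that fixes the time orientation -/
  timeField : ∀ x : M, TangentSpace (𝓡 (n + 1)) x
  continuous_timeField :
    Continuous fun x => (⟨x, timeField x⟩ : TangentBundle (𝓡 (n + 1)) M)
  timelike_timeField : ∀ x, metric x (timeField x) (timeField x) < 0

section Causality

variable {n : ℕ} {k : WithTop ℕ∞} {M : Type*} [TopologicalSpace M] [ChartedSpace (Model n) M]
  [IsManifold (𝓡 (n + 1)) ∞ M]

/-- `v` is a future directed causal vector at `x`. -/
def Spacetime.IsFutureCausal (S : Spacetime n k M) (x : M)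
    (v : TangentSpace (𝓡 (n + 1)) x) : Prop :=
  v ≠ 0 ∧ S.metric x v v ≤ 0 ∧ S.metric x (S.timeField x) v < 0

/-- The velocity vector `γ'(t)`. -/
def velocity (γ : ℝ → M) (t : ℝ) : TangentSpace (𝓡 (n + 1)) (γ t) :=
  mfderiv 𝓘(ℝ, ℝ) (𝓡 (n + 1)) γ t (1 : ℝ)

/-- `γ : [a, b] → M` is a Lipschitz curve: it is continuous and, read in charts, Lipschitz near
each parameter value. By compactness of `[a, b]` this is the same as being Lipschitz for the
distance of any Riemannian metric on `M`. -/
def IsLipschitzCurve (n : ℕ) {M : Type*} [TopologicalSpace M] [ChartedSpace (Model n) M]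
    (γ : ℝ → M) (a b : ℝ) : Prop :=
  ContinuousOn γ (Icc a b) ∧
    ∀ t ∈ Icc a b, ∃ K : NNReal, ∃ s ∈ 𝓝[Icc a b] t,
      LipschitzOnWith K (fun τ => chartAt (Model n) (γ t) (γ τ)) s

/-- `γ : [a, b] → M` is a future directed causal curve. (The values of `γ` outside `[a, b]` are
irrelevant.) -/
def Spacetime.IsCausalCurve (S : Spacetime n k M) (γ : ℝ → M) (a b : ℝ) : Prop :=
  a < b ∧ IsLipschitzCurve n γ a b ∧
    ∀ᵐ t ∂(volume.restrict (Icc a b)),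
      MDifferentiableAt 𝓘(ℝ, ℝ) (𝓡 (n + 1)) γ t ∧ S.IsFutureCausal (γ t) (velocity γ t)

/-- `γ : [a, b] → M` is a future directed timelike curve: a Lipschitz curve that is future directed
timelike almost everywhere, with `g(γ', γ') < -ε` almost everywhere for some `ε > 0`. -/
def Spacetime.IsTimelikeCurve (S : Spacetime n k M) (γ : ℝ → M) (a b : ℝ) : Prop :=
  S.IsCausalCurve γ a b ∧
    ∃ ε > 0, ∀ᵐ t ∂(volume.restrict (Icc a b)),
      S.metric (γ t) (velocity γ t) (velocity γ t) < -ε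

/-- The timelike future `I^+(p, M)`. -/
def Spacetime.timelikeFuture (S : Spacetime n k M) (p : M) : Set M :=
  {q | ∃ (γ : ℝ → M) (a b : ℝ), S.IsTimelikeCurve γ a b ∧ γ a = p ∧ γ b = q}

/-- The past boundary `∂^- A` of `A` within `M`: points of `closure A \ A` from which a future
directed timelike curve starts that runs in `A` afterwards. -/
def Spacetime.pastBoundary (S : Spacetime n k M) (A : Set M) : Set M :=
  {p | p ∈ closure A \ A ∧ ∃ (γ : ℝ → M) (a b : ℝ),
    S.IsTimelikeCurve γ a b ∧ γ a = p ∧ ∀ t ∈ Ioc a b, γ t ∈ A}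

/-- Strong causality at the point `p`. -/
def Spacetime.IsStronglyCausalAt (S : Spacetime n k M) (p : M) : Prop :=
  ∀ U ∈ 𝓝 p, ∃ V ∈ 𝓝 p, V ⊆ U ∧ ∀ (γ : ℝ → M) (a b : ℝ),
    S.IsCausalCurve γ a b → γ a ∈ V → γ b ∈ V → ∀ t ∈ Icc a b, γ t ∈ U

/-- `(u, ρ, p)` is a perfect fluid on the smooth spacetime `S`, and `S` solves the Einstein
equations with it: `Ric - ½ R g = 8π ((ρ + p) u_* ⊗ u_* + p g)` with `u_* = g(u, ·)`. -/
structure Spacetime.SolvesEinsteinPerfectFluid (S : Spacetime n k M)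
    (u : ∀ x : M, TangentSpace (𝓡 (n + 1)) x) (ρ p : M → ℝ) : Prop where
  contMDiff_u : ContMDiff (𝓡 (n + 1)) (𝓡 (n + 1)).tangent ∞
    fun x => (⟨x, u x⟩ : TangentBundle (𝓡 (n + 1)) M)
  contMDiff_ρ : ContMDiff (𝓡 (n + 1)) 𝓘(ℝ, ℝ) ∞ ρ
  contMDiff_p : ContMDiff (𝓡 (n + 1)) 𝓘(ℝ, ℝ) ∞ p
  unit : ∀ x, S.metric x (u x) (u x) = -1
  future : ∀ x, S.IsFutureCausal x (u x)
  einstein : ∀ (x : M) (v w : TangentSpace (𝓡 (n + 1)) x),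
    ricci S.metric x v w - (1 / 2) * scalarCurvature S.metric x * S.metric x v w
      = 8 * Real.pi * ((ρ x + p x) * (S.metric x (u x) v * S.metric x (u x) w)
          + p x * S.metric x v w)

end Causality

section Extension

variable {n : ℕ} {M N : Type*} [TopologicalSpace M] [ChartedSpace (Model n) M]
  [IsManifold (𝓡 (n + 1)) ∞ M]
  [TopologicalSpace N] [ChartedSpace (Model n) N] [IsManifold (𝓡 (n + 1)) ∞ N]

/-- The continuous spacetime `S'` on `N` is a continuous extension of the smooth spacetime `S` on
`M`, of the same dimension, through the isometric embedding `ι`. -/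
structure IsContinuousExtension (S : Spacetime n ∞ M) (S' : Spacetime n 0 N) (ι : M → N) :
    Prop where
  isSmoothEmbedding : Manifold.IsSmoothEmbedding (𝓡 (n + 1)) (𝓡 (n + 1)) ∞ ι
  isometric : ∀ (x : M) (v w : TangentSpace (𝓡 (n + 1)) x),
    S'.metric (ι x) (mfderiv (𝓡 (n + 1)) (𝓡 (n + 1)) ι x v)
      (mfderiv (𝓡 (n + 1)) (𝓡 (n + 1)) ι x w) = S.metric x v w
  timeOrientation : ∀ (x : M) (v : TangentSpace (𝓡 (n + 1)) x),
    S.IsFutureCausal x v →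
      S'.IsFutureCausal (ι x) (mfderiv (𝓡 (n + 1)) (𝓡 (n + 1)) ι x v)
  proper : range ι ≠ univ

/-- `f'` is a continuous extension of the function `f` on `M` to `M ∪ {O}`, with the topology of
the subspace `M ∪ {O}` of `N`; values of `f'` elsewhere are irrelevant. -/
def IsContinuousExtensionOf (ι : M → N) (O : N) (f : M → ℝ) (f' : N → ℝ) : Prop :=
  ContinuousOn f' (range ι ∪ {O}) ∧ ∀ x, f' (ι x) = f x

/-- A tensor `T` of type `(0,2)` on `M` extends continuously to `M ∪ {O}`: in some coordinate
system `e` of `N` around `O`, with domain `U`, the components `T_{ij}` in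
`T = ∑ T_{ij} dx^i ⊗ dx^j` on `U ∩ M` extend to continuous functions on `(U ∩ M) ∪ {O}`. -/
def TensorExtendsContinuously (ι : M → N) (O : N)
    (T : ∀ x : M, TangentSpace (𝓡 (n + 1)) x → TangentSpace (𝓡 (n + 1)) x → ℝ) : Prop :=
  ∃ e ∈ IsManifold.maximalAtlas (𝓡 (n + 1)) ∞ N, O ∈ e.source ∧
    ∃ F : Fin (n + 1) → Fin (n + 1) → N → ℝ,
      (∀ i j, ContinuousOn (F i j) ((e.source ∩ range ι) ∪ {O})) ∧
      ∀ x : M, ι x ∈ e.source → ∀ v w : TangentSpace (𝓡 (n + 1)) x,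
        T x v w = ∑ i, ∑ j, F i j (ι x)
          * coordForm e (ι x) (mfderiv (𝓡 (n + 1)) (𝓡 (n + 1)) ι x v) i
          * coordForm e (ι x) (mfderiv (𝓡 (n + 1)) (𝓡 (n + 1)) ι x w) j

/-- All integral curves of `u` have past endpoint `O` within `N`, and the extended curves are future
directed timelike on compact domains: every integral curve `c : (α, b] → M` of `u` continues to
the past to an integral curve `d : (a, b] → M` such that the curve `[a, b] → N` that
starts at `O` and follows `ι ∘ d` on `(a, b]` is (continuous and) future directed timelike. -/
def IntegralCurvesHavePastEndpoint (S' : Spacetime n 0 N) (ι : M → N)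
    (u : ∀ x : M, TangentSpace (𝓡 (n + 1)) x) (O : N) : Prop :=
  ∀ (c : ℝ → M) (α b : ℝ), α < b → IsMIntegralCurveOn c u (Ioc α b) →
    ∃ (d : ℝ → M) (a : ℝ), a ≤ α ∧ EqOn d c (Ioc α b) ∧ IsMIntegralCurveOn d u (Ioc a b) ∧
      ∃ γ : ℝ → N, γ a = O ∧ (∀ t ∈ Ioc a b, γ t = ι (d t)) ∧ S'.IsTimelikeCurve γ a b

end Extension

end Spacetimes

end

/-!
Let `T = c g + μ u_* ⊗ u_*` be a tensor that extends continuously to `O` together with `μ`, where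
`μ(O) ≠ 0`. The trace of `T` with respect to `g` determines `c`, so in coordinates around `O` the
matrix of `u ⊗ u` converges at `O`. The limit `W` is not zero, since `g(u, u) = -1` passes to the
limit. On the other hand, let `v` be a future timelike vector at `O`. The coordinate line from `O`
in the direction `v` is timelike near `O`, so its points there lie in `I^+(O) ⊆ M`. The integral
curve of `u` from `O` to such a point stays near `O` by strong causality, and by Cauchy's mean value
theorem `v^j u^i = v^i u^j` holds somewhere on it. In the limit `v^j W_{im} = v^i W_{jm}`.
Since `v` ranges over an open set and the dimension is at least two, `W = 0`, a contradiction. For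
the Einstein equations, `T` is the Ricci tensor and `μ = 8π (ρ + p)`.
-/

noncomputable section

namespace Spacetimes

open Bundle Filter Matrix

section LinearAlgebra

theorem IsLorentzian.nondegenerate {n : ℕ} {V : Type*} [AddCommGroup V] [Module ℝ V]
    {B : LinearMap.BilinForm ℝ V} (hB : IsLorentzian (n := n) B) : B.Nondegenerate := by
  obtain ⟨b, hb⟩ := hB
  have hdiag : LinearMap.BilinForm.toMatrix b B = diagonal fun i => if i = 0 then -1 else 1 := by
    ext i j
    simp only [LinearMap.BilinForm.toMatrix_apply, hb, diagonal_apply]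
  rw [LinearMap.BilinForm.nondegenerate_iff_det_ne_zero b, hdiag, det_diagonal]
  exact Finset.prod_ne_zero_iff.2 fun i _ => by split_ifs <;> norm_num

theorem eq_zero_of_eventually_parallel {K κ : Type*} [NontriviallyNormedField K] [Nontrivial κ]
    {v w₀ : κ → K} (h : ∀ᶠ w in 𝓝 w₀, ∀ i j, w j * v i = w i * v j) : v = 0 := by
  classical
  funext i
  obtain ⟨j, hji⟩ := exists_ne i
  have hline : Tendsto (fun t : K => w₀ + t • Pi.single j 1) (𝓝[≠] 0) (𝓝 w₀) :=
    tendsto_nhdsWithin_of_tendsto_nhds (Continuous.tendsto' (by fun_prop) _ _ (by simp))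
  obtain ⟨t, hwt, ht : t ≠ 0⟩ := ((hline.eventually h).and self_mem_nhdsWithin).exists
  have hw := h.self_of_nhds i j
  have hwt := hwt i j
  simp only [Pi.add_apply, Pi.smul_apply, Pi.single_eq_same, Pi.single_eq_of_ne hji.symm,
    smul_eq_mul, mul_one, mul_zero, add_zero] at hwt
  exact (mul_eq_zero.1 (by linear_combination hwt - hw : t * v i = 0)).resolve_left ht

theorem mul_apply_eq_of_frequently_of_tendsto_vecMulVec {R κ X : Type*} [Semigroup R]
    [TopologicalSpace R] [ContinuousMul R] [T2Space R] {l : Filter X} {u : X → κ → R}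
    {W : Matrix κ κ R} {a b : R} {i j : κ} (h : ∃ᶠ x in l, a * u x i = b * u x j)
    (hW : Tendsto (fun x => vecMulVec (u x) (u x)) l (𝓝 W)) (m : κ) : a * W i m = b * W j m := by
  have hclosed : IsClosed {A : Matrix κ κ R | a * A i m = b * A j m} :=
    isClosed_eq (by fun_prop) (by fun_prop)
  refine hclosed.mem_of_frequently_of_tendsto (h.mono fun x hx => ?_) hW
  simp only [mem_ofPred_eq, vecMulVec_apply, ← mul_assoc, hx]

theorem trace_mul_eq_of_tendsto_vecMulVec {R κ X : Type*} [CommRing R] [TopologicalSpace R]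
    [IsTopologicalRing R] [T2Space R] [Fintype κ] {l : Filter X} [l.NeBot]
    {A : X → Matrix κ κ R} {u : X → κ → R} {A₀ W : Matrix κ κ R} {q : R} (hA : Tendsto A l (𝓝 A₀))
    (hu : ∀ᶠ x in l, (u x ᵥ* A x) ⬝ᵥ u x = q)
    (hW : Tendsto (fun x => vecMulVec (u x) (u x)) l (𝓝 W)) : (W * A₀).trace = q := by
  refine tendsto_nhds_unique ((continuous_id.matrix_trace.tendsto _).comp (hW.mul hA))
    (tendsto_const_nhds.congr' ?_)
  filter_upwards [hu] with x hux
  simp only [Function.comp_apply, id_eq, vecMulVec_mul, trace_vecMulVec, ← hux, dotProduct_comm]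

end LinearAlgebra

section FluidMatrix

variable {K κ X : Type*} [Field K] [Fintype κ]

/-- The components `c A + μ a ⊗ a`, where `a = A(u, ·)`, of a tensor of perfect fluid type. Here `A`
is the matrix of the metric and `u` the components of the fluid velocity. -/
def fluidMatrix (A : Matrix κ κ K) (u : κ → K) (c μ : K) : Matrix κ κ K :=
  c • A + μ • vecMulVec (u ᵥ* A) (u ᵥ* A)

variable [DecidableEq κ]

theorem vecMul_vecMul_inv {A : Matrix κ κ K} (hA : IsUnit A.det) (u : κ → K) :
    (u ᵥ* A) ᵥ* A⁻¹ = u := by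
  rw [vecMul_vecMul, mul_nonsing_inv _ hA, vecMul_one]

theorem trace_inv_mul_fluidMatrix {A : Matrix κ κ K} (hA : IsUnit A.det) (u : κ → K) (c μ : K) :
    (A⁻¹ * fluidMatrix A u c μ).trace = c * Fintype.card κ + μ * ((u ᵥ* A) ⬝ᵥ u) := by
  rw [fluidMatrix, Matrix.mul_add, Matrix.mul_smul, Matrix.mul_smul, nonsing_inv_mul _ hA,
    mul_vecMulVec, trace_add, trace_smul, trace_smul, trace_one, trace_vecMulVec, dotProduct_comm,
    dotProduct_mulVec, vecMul_vecMul_inv hA, dotProduct_comm, smul_eq_mul, smul_eq_mul]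

theorem transpose_inv_mul_fluidMatrix_mul_inv {A : Matrix κ κ K} (hA : IsUnit A.det) (u : κ → K)
    (c μ : K) : A⁻¹ᵀ * fluidMatrix A u c μ * A⁻¹ = c • A⁻¹ᵀ + μ • vecMulVec u u := by
  rw [fluidMatrix, Matrix.mul_add, Matrix.add_mul, Matrix.mul_smul, Matrix.mul_smul,
    Matrix.smul_mul, Matrix.smul_mul, Matrix.mul_assoc, mul_nonsing_inv _ hA, Matrix.mul_one,
    mul_vecMulVec, vecMulVec_mul, mulVec_transpose, vecMul_vecMul_inv hA]

theorem vecMulVec_self_eq_of_fluidMatrix {A : Matrix κ κ K} (hA : IsUnit A.det) (u : κ → K) (c : K)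
    {μ : K} (hμ : μ ≠ 0) (hκ : (Fintype.card κ : K) ≠ 0) :
    vecMulVec u u = μ⁻¹ • (A⁻¹ᵀ * fluidMatrix A u c μ * A⁻¹ -
      (((A⁻¹ * fluidMatrix A u c μ).trace - μ * ((u ᵥ* A) ⬝ᵥ u)) / Fintype.card κ) • A⁻¹ᵀ) := by
  rw [trace_inv_mul_fluidMatrix hA, add_sub_cancel_right, mul_div_cancel_right₀ _ hκ,
    transpose_inv_mul_fluidMatrix_mul_inv hA, add_sub_cancel_left, smul_smul, inv_mul_cancel₀ hμ,
    one_smul]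

variable [TopologicalSpace K] [IsTopologicalDivisionRing K]

theorem tendsto_matrix_inv {l : Filter X} {A : X → Matrix κ κ K} {A₀ : Matrix κ κ K}
    (hA : Tendsto A l (𝓝 A₀)) (hA₀ : IsUnit A₀.det) : Tendsto (fun x => (A x)⁻¹) l (𝓝 A₀⁻¹) := by
  have hdet : ContinuousAt Ring.inverse A₀.det := by
    rw [Ring.inverse_eq_inv']
    exact continuousAt_inv₀ hA₀.ne_zero
  exact (continuousAt_matrix_inv A₀ hdet).tendsto.comp hA

theorem exists_tendsto_vecMulVec_of_fluidMatrix [Nonempty κ] [CharZero K] [T1Space K] {l : Filter X}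
    {A : X → Matrix κ κ K} {u : X → κ → K} {c μ : X → K} {A₀ F₀ : Matrix κ κ K} {q μ₀ : K}
    (hA : Tendsto A l (𝓝 A₀)) (hdet : ∀ᶠ x in l, IsUnit (A x).det) (hA₀ : IsUnit A₀.det)
    (hu : ∀ᶠ x in l, (u x ᵥ* A x) ⬝ᵥ u x = q) (hμ : Tendsto μ l (𝓝 μ₀)) (hμ₀ : μ₀ ≠ 0)
    (hF : Tendsto (fun x => fluidMatrix (A x) (u x) (c x) (μ x)) l (𝓝 F₀)) :
    ∃ W, Tendsto (fun x => vecMulVec (u x) (u x)) l (𝓝 W) := by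
  have hcard : (Fintype.card κ : K) ≠ 0 := Nat.cast_ne_zero.2 Fintype.card_ne_zero
  have hInv := tendsto_matrix_inv hA hA₀
  have hInvT := (continuous_id.matrix_transpose.tendsto A₀⁻¹).comp hInv
  have htr := (continuous_id.matrix_trace.tendsto _).comp (hInv.mul hF)
  refine ⟨_, Tendsto.congr' ?_ ((hμ.inv₀ hμ₀).smul (((hInvT.mul hF).mul hInv).sub
    (((htr.sub (hμ.mul_const q)).div_const (Fintype.card κ : K)).smul hInvT)))⟩
  filter_upwards [hdet, hu, hμ.eventually_ne hμ₀] with x hdetx hux hμx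
  rw [vecMulVec_self_eq_of_fluidMatrix hdetx (u x) (c x) hμx hcard, hux]
  rfl

end FluidMatrix

section Coordinates

variable {n : ℕ} {N : Type*} [TopologicalSpace N] [ChartedSpace (Model n) N]
  {e : OpenPartialHomeomorph N (Model n)}

theorem mdifferentiable_of_mem_maximalAtlas (he : e ∈ IsManifold.maximalAtlas (𝓡 (n + 1)) ∞ N) :
    e.MDifferentiable (𝓡 (n + 1)) (𝓡 (n + 1)) :=
  ⟨(contMDiffOn_of_mem_maximalAtlas he).mdifferentiableOn (by simp),
    (contMDiffOn_symm_of_mem_maximalAtlas he).mdifferentiableOn (by simp)⟩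

/-- The isomorphism `v ↦ (dx^i(v))_i` of the tangent space at `x` with `ℝ^{n+1}` given by the
coordinates `e`. -/
def coordEquiv (he : e.MDifferentiable (𝓡 (n + 1)) (𝓡 (n + 1))) {x : N}
    (hx : x ∈ e.source) : TangentSpace (𝓡 (n + 1)) x ≃L[ℝ] (Fin (n + 1) → ℝ) :=
  (he.mfderiv hx).trans (EuclideanSpace.equiv (Fin (n + 1)) ℝ)

theorem coordEquiv_apply (he : e.MDifferentiable (𝓡 (n + 1)) (𝓡 (n + 1))) {x : N}
    (hx : x ∈ e.source) (v : TangentSpace (𝓡 (n + 1)) x) :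
    coordEquiv he hx v = coordForm e x v :=
  rfl

theorem eventually_nhds_coordForm (he : e.MDifferentiable (𝓡 (n + 1)) (𝓡 (n + 1))) {x : N}
    (hx : x ∈ e.source) {v : TangentSpace (𝓡 (n + 1)) x} {P : (Fin (n + 1) → ℝ) → Prop}
    (h : ∀ᶠ w in 𝓝 v, P (coordForm e x w)) : ∀ᶠ ξ in 𝓝 (coordForm e x v), P ξ := by
  rw [← coordEquiv_apply he hx, ← (coordEquiv he hx).map_nhds_eq]
  exact h

theorem coordForm_coordVec (he : e.MDifferentiable (𝓡 (n + 1)) (𝓡 (n + 1))) {y : Model n}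
    (hy : y ∈ e.target) (i : Fin (n + 1)) :
    coordForm e (e.symm y) (coordVec e y i) = Pi.single i 1 := by
  have h := DFunLike.congr_fun (he.comp_symm_deriv hy) (EuclideanSpace.single i (1 : ℝ) : Model n)
  exact congrArg (WithLp.ofLp : Model n → Fin (n + 1) → ℝ) h

/-- The basis of the tangent space at `x` formed by the coordinate vectors `∂_i`. -/
def coordBasis (he : e.MDifferentiable (𝓡 (n + 1)) (𝓡 (n + 1))) {x : N}
    (hx : x ∈ e.source) : Module.Basis (Fin (n + 1)) ℝ (TangentSpace (𝓡 (n + 1)) x) :=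
  .ofEquivFun (coordEquiv he hx).toLinearEquiv

theorem metricComp_eq_toMatrix (he : e.MDifferentiable (𝓡 (n + 1)) (𝓡 (n + 1)))
    (g : ∀ x : N, LinearMap.BilinForm ℝ (TangentSpace (𝓡 (n + 1)) x)) {x : N}
    (hx : x ∈ e.source) :
    metricComp g e (e x) = LinearMap.BilinForm.toMatrix (coordBasis he hx) (g x) := by
  obtain ⟨y, hy, rfl⟩ : ∃ y ∈ e.target, e.symm y = x := ⟨e x, e.map_source hx, e.left_inv hx⟩
  have hbasis : ∀ i, coordBasis he hx i = coordVec e y i := fun i => by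
    rw [coordBasis, Module.Basis.coe_ofEquivFun]
    refine (coordEquiv he hx).toLinearEquiv.symm_apply_eq.2 ?_
    exact (coordForm_coordVec he hy i).symm
  ext i j
  rw [e.right_inv hy, LinearMap.BilinForm.toMatrix_apply, hbasis, hbasis]
  rfl

theorem apply_eq_vecMul_metricComp_dotProduct (he : e.MDifferentiable (𝓡 (n + 1)) (𝓡 (n + 1)))
    (g : ∀ x : N, LinearMap.BilinForm ℝ (TangentSpace (𝓡 (n + 1)) x)) {x : N}
    (hx : x ∈ e.source) (v w : TangentSpace (𝓡 (n + 1)) x) :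
    g x v w = (coordForm e x v ᵥ* metricComp g e (e x)) ⬝ᵥ coordForm e x w := by
  rw [LinearMap.BilinForm.apply_eq_dotProduct_toMatrix_mulVec (coordBasis he hx),
    ← metricComp_eq_toMatrix he g hx, dotProduct_mulVec]
  rfl

theorem continuousOn_coordForm [IsManifold (𝓡 (n + 1)) ∞ N]
    (he : e ∈ IsManifold.maximalAtlas (𝓡 (n + 1)) ∞ N) :
    ContinuousOn (fun q : TangentBundle (𝓡 (n + 1)) N => coordForm e q.1 q.2)
      (TotalSpace.proj ⁻¹' e.source) := by
  have hmap : ContinuousOn (tangentMapWithin (𝓡 (n + 1)) (𝓡 (n + 1)) e e.source)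
      (TotalSpace.proj ⁻¹' e.source) :=
    (contMDiffOn_of_mem_maximalAtlas he).continuousOn_tangentMapWithin (by simp)
      e.open_source.uniqueMDiffOn
  have hsnd : ContinuousOn (fun q : TangentBundle (𝓡 (n + 1)) N =>
      (tangentMapWithin (𝓡 (n + 1)) (𝓡 (n + 1)) e e.source q).2) (TotalSpace.proj ⁻¹' e.source) :=
    (continuous_snd.comp
      (tangentBundleModelSpaceHomeomorph (𝓡 (n + 1))).continuous).comp_continuousOn hmap
  refine ((EuclideanSpace.equiv (Fin (n + 1)) ℝ).continuous.comp_continuousOn hsnd).congr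
    fun q hq => ?_
  funext i
  simp only [coordForm, ← mfderivWithin_of_isOpen e.open_source (show q.1 ∈ e.source from hq)]
  rfl

end Coordinates

section Metric

variable {n : ℕ} {k : WithTop ℕ∞} {N : Type*} [TopologicalSpace N] [ChartedSpace (Model n) N]
  [IsManifold (𝓡 (n + 1)) ∞ N] {e : OpenPartialHomeomorph N (Model n)} {x : N}

theorem Spacetime.isUnit_det_metricComp (S : Spacetime n k N)
    (he : e.MDifferentiable (𝓡 (n + 1)) (𝓡 (n + 1))) (hx : x ∈ e.source) :
    IsUnit (metricComp S.metric e (e x)).det := by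
  rw [metricComp_eq_toMatrix he S.metric hx, isUnit_iff_ne_zero]
  exact (LinearMap.BilinForm.nondegenerate_iff_det_ne_zero _).1 (S.isLorentzian x).nondegenerate

theorem Spacetime.continuousAt_metricComp (S : Spacetime n k N)
    (he : e ∈ IsManifold.maximalAtlas (𝓡 (n + 1)) ∞ N) (hx : x ∈ e.source) :
    ContinuousAt (fun z => metricComp S.metric e (e z)) x := by
  have hcomp : ContinuousAt (metricComp S.metric e) (e x) :=
    continuousAt_pi.2 fun i => continuousAt_pi.2 fun j =>
      (S.contDiffOn e he i j).continuousOn.continuousAt (e.open_target.mem_nhds (e.map_source hx))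
  exact hcomp.comp (e.continuousAt hx)

theorem Spacetime.continuousAt_metric (S : Spacetime n k N) {α : Type*} [TopologicalSpace α]
    {f : α → N} {v w : ∀ a, TangentSpace (𝓡 (n + 1)) (f a)} {a₀ : α}
    (hv : ContinuousAt (fun a => (⟨f a, v a⟩ : TangentBundle (𝓡 (n + 1)) N)) a₀)
    (hw : ContinuousAt (fun a => (⟨f a, w a⟩ : TangentBundle (𝓡 (n + 1)) N)) a₀) :
    ContinuousAt (fun a => S.metric (f a) (v a) (w a)) a₀ := by
  set e := chartAt (Model n) (f a₀)
  have he : e ∈ IsManifold.maximalAtlas (𝓡 (n + 1)) ∞ N := IsManifold.chart_mem_maximalAtlas _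
  have hf₀ : f a₀ ∈ e.source := mem_chart_source _ _
  have hf : ContinuousAt f a₀ := (FiberBundle.continuous_proj (Model n) _).continuousAt.comp hv
  have hcoord : ∀ {u : ∀ a, TangentSpace (𝓡 (n + 1)) (f a)},
      ContinuousAt (fun a => (⟨f a, u a⟩ : TangentBundle (𝓡 (n + 1)) N)) a₀ →
        ContinuousAt (fun a => coordForm e (f a) (u a)) a₀ := fun {u} hu =>
    ContinuousAt.comp (f := fun a => (⟨f a, u a⟩ : TangentBundle (𝓡 (n + 1)) N))
      ((continuousOn_coordForm he).continuousAt
        ((e.open_source.preimage (FiberBundle.continuous_proj (Model n) _)).mem_nhds hf₀)) hu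
  have hG : ContinuousAt (fun a => metricComp S.metric e (e (f a))) a₀ :=
    ContinuousAt.comp (f := f) (S.continuousAt_metricComp he hf₀) hf
  have hprod : Continuous fun q : (Fin (n + 1) → ℝ) × Matrix (Fin (n + 1)) (Fin (n + 1)) ℝ ×
      (Fin (n + 1) → ℝ) => (q.1 ᵥ* q.2.1) ⬝ᵥ q.2.2 := by fun_prop
  refine (hprod.continuousAt.comp ((hcoord hv).prodMk (hG.prodMk (hcoord hw)))).congr ?_
  filter_upwards [hf.eventually (e.open_source.mem_nhds hf₀)] with a ha
  exact (apply_eq_vecMul_metricComp_dotProduct (mdifferentiable_of_mem_maximalAtlas he) S.metric ha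
    (v a) (w a)).symm

end Metric

section Causality

variable {n : ℕ} {k : WithTop ℕ∞} {N : Type*} [TopologicalSpace N] [ChartedSpace (Model n) N]
  [IsManifold (𝓡 (n + 1)) ∞ N] {S : Spacetime n k N} {x : N}

/-- `v` is a future directed timelike vector at `x`. -/
def Spacetime.IsFutureTimelike (S : Spacetime n k N) (x : N) (v : TangentSpace (𝓡 (n + 1)) x) :
    Prop :=
  S.metric x v v < 0 ∧ S.metric x (S.timeField x) v < 0

theorem Spacetime.IsFutureTimelike.isFutureCausal {v : TangentSpace (𝓡 (n + 1)) x}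
    (hv : S.IsFutureTimelike x v) : S.IsFutureCausal x v :=
  ⟨by rintro rfl; simp [Spacetime.IsFutureTimelike] at hv, hv.1.le, hv.2⟩

theorem Spacetime.eventually_isFutureTimelike (S : Spacetime n k N) (x : N) :
    ∀ᶠ v in 𝓝 (S.timeField x), S.IsFutureTimelike x v := by
  have hmk (v₀ : TangentSpace (𝓡 (n + 1)) x) : ContinuousAt
      (fun v : TangentSpace (𝓡 (n + 1)) x => (⟨x, v⟩ : TangentBundle (𝓡 (n + 1)) N)) v₀ :=
    (FiberBundle.continuous_totalSpaceMk (Model n) (TangentSpace (𝓡 (n + 1))) x).continuousAt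
  exact ((S.continuousAt_metric (hmk _) (hmk _)).eventually_lt_const (S.timelike_timeField x)).and
    ((S.continuousAt_metric continuousAt_const (hmk _)).eventually_lt_const
      (S.timelike_timeField x))

variable {γ : ℝ → N} {a b t₀ : ℝ}

theorem continuousAt_velocity (hγ : ContMDiffAt 𝓘(ℝ, ℝ) (𝓡 (n + 1)) 1 γ t₀) :
    ContinuousAt (fun t => (⟨γ t, velocity γ t⟩ : TangentBundle (𝓡 (n + 1)) N)) t₀ := by
  obtain ⟨s, hs, hγs⟩ := (contMDiffAt_iff_contMDiffOn_nhds (by simp)).1 hγ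
  obtain ⟨o, hos, ho, hto⟩ := mem_nhds_iff.1 hs
  have hsec : ContinuousOn (fun t : ℝ => (⟨t, 1⟩ : TangentBundle 𝓘(ℝ, ℝ) ℝ)) o :=
    ((tangentBundleModelSpaceHomeomorph 𝓘(ℝ, ℝ)).symm.continuous.comp
      (continuous_id.prodMk continuous_const)).continuousOn
  have hmap := (((hγs.mono hos).continuousOn_tangentMapWithin le_rfl ho.uniqueMDiffOn).comp hsec
    fun t ht => ht).continuousAt (ho.mem_nhds hto)
  refine hmap.congr ?_
  filter_upwards [ho.mem_nhds hto] with t ht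
  simp only [Function.comp_apply, tangentMapWithin, mfderivWithin_of_isOpen ho ht]
  rfl

theorem isLipschitzCurve_of_contMDiffAt
    (hγ : ∀ t ∈ Icc a b, ContMDiffAt 𝓘(ℝ, ℝ) (𝓡 (n + 1)) 1 γ t) : IsLipschitzCurve n γ a b := by
  refine ⟨fun t ht => (hγ t ht).continuousAt.continuousWithinAt, fun t ht => ?_⟩
  have hchart : ContMDiffAt 𝓘(ℝ, ℝ) (𝓡 (n + 1)) 1 (fun τ => chartAt (Model n) (γ t) (γ τ)) t :=
    ((contMDiffAt_of_mem_maximalAtlas (n := ∞) (IsManifold.chart_mem_maximalAtlas _)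
      (mem_chart_source _ _)).of_le (by simp)).comp t (hγ t ht)
  obtain ⟨K, s, hs, hK⟩ := hchart.contDiffAt.exists_lipschitzOnWith
  exact ⟨K, s, mem_nhdsWithin_of_mem_nhds hs, hK⟩

theorem Spacetime.isTimelikeCurve_of_contMDiffAt {ε : ℝ} (hab : a < b) (hε : 0 < ε)
    (hγ : ∀ t ∈ Icc a b, ContMDiffAt 𝓘(ℝ, ℝ) (𝓡 (n + 1)) 1 γ t)
    (hvel : ∀ t ∈ Icc a b, S.IsFutureTimelike (γ t) (velocity γ t) ∧
      S.metric (γ t) (velocity γ t) (velocity γ t) < -ε) : S.IsTimelikeCurve γ a b :=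
  ⟨⟨hab, isLipschitzCurve_of_contMDiffAt hγ, ae_restrict_of_forall_mem measurableSet_Icc fun t ht =>
      ⟨(hγ t ht).mdifferentiableAt (by simp), (hvel t ht).1.isFutureCausal⟩⟩,
    ε, hε, ae_restrict_of_forall_mem measurableSet_Icc fun t ht => (hvel t ht).2⟩

theorem Spacetime.eventually_isTimelikeCurve (hγ : ContMDiffAt 𝓘(ℝ, ℝ) (𝓡 (n + 1)) 1 γ t₀)
    (hvel : S.IsFutureTimelike (γ t₀) (velocity γ t₀)) :
    ∀ᶠ s in 𝓝[>] t₀, S.IsTimelikeCurve γ t₀ s := by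
  have hv := continuousAt_velocity hγ
  have hT : ContinuousAt (fun t => (⟨γ t, S.timeField (γ t)⟩ : TangentBundle (𝓡 (n + 1)) N)) t₀ :=
    ContinuousAt.comp (f := γ) S.continuous_timeField.continuousAt hγ.continuousAt
  obtain ⟨ε, hε, hεv⟩ : ∃ ε > 0, S.metric (γ t₀) (velocity γ t₀) (velocity γ t₀) < -ε :=
    ⟨-S.metric (γ t₀) (velocity γ t₀) (velocity γ t₀) / 2, by linarith [hvel.1],
      by linarith [hvel.1]⟩
  have hnear : ∀ᶠ t in 𝓝 t₀, ContMDiffAt 𝓘(ℝ, ℝ) (𝓡 (n + 1)) 1 γ t ∧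
      S.IsFutureTimelike (γ t) (velocity γ t) ∧
      S.metric (γ t) (velocity γ t) (velocity γ t) < -ε :=
    ((contMDiffAt_iff_contMDiffAt_nhds (by simp)).1 hγ).and
      ((((S.continuousAt_metric hv hv).eventually_lt_const hvel.1).and
        ((S.continuousAt_metric hT hv).eventually_lt_const hvel.2)).and
          ((S.continuousAt_metric hv hv).eventually_lt_const hεv))
  have hIcc : Tendsto (Icc t₀) (𝓝[>] t₀) (𝓝 t₀).smallSets :=
    tendsto_const_nhds.Icc (tendsto_id.mono_left nhdsWithin_le_nhds)
  filter_upwards [hIcc.eventually (eventually_smallSets_forall.2 hnear), self_mem_nhdsWithin]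
    with s hs hts
  exact isTimelikeCurve_of_contMDiffAt hts hε (fun t ht => (hs t ht).1) fun t ht => (hs t ht).2

end Causality

section CoordinateLines

variable {n : ℕ} {N : Type*} [TopologicalSpace N] [ChartedSpace (Model n) N]
  {e : OpenPartialHomeomorph N (Model n)} {x : N} {v : TangentSpace (𝓡 (n + 1)) x}

theorem tangentMap_symm_tangentMap (he : e.MDifferentiable (𝓡 (n + 1)) (𝓡 (n + 1)))
    (hx : x ∈ e.source) :
    tangentMap (𝓡 (n + 1)) (𝓡 (n + 1)) e.symm (tangentMap (𝓡 (n + 1)) (𝓡 (n + 1)) e ⟨x, v⟩)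
      = ⟨x, v⟩ := by
  have hfib : (⟨e.symm (e x), v⟩ : TangentBundle (𝓡 (n + 1)) N) = ⟨x, v⟩ :=
    congrArg (fun y => (⟨y, (v : Model n)⟩ : TangentBundle (𝓡 (n + 1)) N)) (e.left_inv hx)
  exact (congrArg (TotalSpace.mk (e.symm (e x)))
    (DFunLike.congr_fun (he.symm_comp_deriv hx) v)).trans hfib

/-- The curve through `x` with velocity `v` that is a straight line in the coordinates `e`. -/
def coordLine (e : OpenPartialHomeomorph N (Model n)) (x : N) (v : TangentSpace (𝓡 (n + 1)) x)
    (t : ℝ) : N :=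
  e.symm (e x + t • WithLp.toLp 2 (coordForm e x v))

theorem coordLine_zero (hx : x ∈ e.source) : coordLine e x v 0 = x := by
  rw [coordLine, zero_smul, add_zero, e.left_inv hx]

theorem eventually_apply_coordLine (hx : x ∈ e.source) :
    ∀ᶠ t in 𝓝 (0 : ℝ), e (coordLine e x v t) - e x = t • WithLp.toLp 2 (coordForm e x v) := by
  have hline : Tendsto (fun t : ℝ => e x + t • WithLp.toLp 2 (coordForm e x v)) (𝓝 0)
      (𝓝 (e x)) := Continuous.tendsto' (by fun_prop) _ _ (by simp)
  filter_upwards [hline.eventually (e.open_target.mem_nhds (e.map_source hx))] with t ht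
  rw [coordLine, e.right_inv ht, add_sub_cancel_left]

theorem velocity_coordLine_zero (he : e.MDifferentiable (𝓡 (n + 1)) (𝓡 (n + 1)))
    (hx : x ∈ e.source) :
    (⟨coordLine e x v 0, velocity (coordLine e x v) 0⟩ : TangentBundle (𝓡 (n + 1)) N) = ⟨x, v⟩ := by
  set w : Model n := WithLp.toLp 2 (coordForm e x v)
  have hline : HasMFDerivAt 𝓘(ℝ, ℝ) (𝓡 (n + 1)) (fun t : ℝ => e x + t • w) 0
      (ContinuousLinearMap.toSpanSingleton ℝ w) := by
    have hder : HasDerivAt (fun t : ℝ => e x + t • w) w 0 := by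
      simpa using ((hasDerivAt_id (0 : ℝ)).smul_const w).const_add (e x)
    exact hder.hasFDerivAt.hasMFDerivAt
  have hbase : e x + (0 : ℝ) • w = e x := by rw [zero_smul, add_zero]
  have hfib : (mfderiv 𝓘(ℝ, ℝ) (𝓡 (n + 1)) (fun t : ℝ => e x + t • w) 0) (1 : ℝ) = w := by
    rw [hline.mfderiv]
    exact one_smul ℝ w
  have hmap : tangentMap 𝓘(ℝ, ℝ) (𝓡 (n + 1)) (fun t : ℝ => e x + t • w) ⟨0, (1 : ℝ)⟩ =
      tangentMap (𝓡 (n + 1)) (𝓡 (n + 1)) e ⟨x, v⟩ :=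
    congrArg₂ (fun y z : Model n => (⟨y, z⟩ : TangentBundle (𝓡 (n + 1)) (Model n))) hbase hfib
  rw [← tangentMap_symm_tangentMap he hx (v := v), ← hmap]
  exact tangentMap_comp_at (⟨0, (1 : ℝ)⟩ : TangentBundle 𝓘(ℝ, ℝ) ℝ)
    (hbase.symm ▸ he.mdifferentiableAt_symm (e.map_source hx)) hline.mdifferentiableAt

theorem contMDiffAt_coordLine (he : e ∈ IsManifold.maximalAtlas (𝓡 (n + 1)) ∞ N)
    (hx : x ∈ e.source) : ContMDiffAt 𝓘(ℝ, ℝ) (𝓡 (n + 1)) ∞ (coordLine e x v) 0 := by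
  have hline : ContMDiffAt 𝓘(ℝ, ℝ) (𝓡 (n + 1)) ∞
      (fun t : ℝ => e x + t • WithLp.toLp 2 (coordForm e x v)) 0 :=
    ContDiffAt.contMDiffAt (by fun_prop)
  exact (contMDiffAt_symm_of_mem_maximalAtlas he (by simpa using e.map_source hx)).comp 0 hline

theorem eventually_isTimelikeCurve_coordLine [IsManifold (𝓡 (n + 1)) ∞ N] {k : WithTop ℕ∞}
    {S : Spacetime n k N}
    (he : e ∈ IsManifold.maximalAtlas (𝓡 (n + 1)) ∞ N) (hx : x ∈ e.source)
    (hv : S.IsFutureTimelike x v) :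
    ∀ᶠ s in 𝓝[>] (0 : ℝ), S.IsTimelikeCurve (coordLine e x v) 0 s := by
  have hvel : ∀ q : TangentBundle (𝓡 (n + 1)) N, q = ⟨x, v⟩ → S.IsFutureTimelike q.1 q.2 := by
    rintro q rfl
    exact hv
  exact Spacetime.eventually_isTimelikeCurve ((contMDiffAt_coordLine he hx).of_le (by simp))
    (hvel _ (velocity_coordLine_zero (mdifferentiable_of_mem_maximalAtlas he) hx))

end CoordinateLines

section Extension

theorem tendsto_comap_of_continuousWithinAt {X Y Z : Type*} [TopologicalSpace Y]
    [TopologicalSpace Z] {φ : X → Y} {y : Y} {f : Y → Z} {t : Set Y}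
    (hf : ContinuousWithinAt f t y) (ht : ∀ᶠ x in comap φ (𝓝 y), φ x ∈ t) :
    Tendsto (fun x => f (φ x)) (comap φ (𝓝 y)) (𝓝 (f y)) :=
  Tendsto.comp hf (tendsto_nhdsWithin_iff.2 ⟨tendsto_comap, ht⟩)

theorem IsContinuousExtensionOf.tendsto {M N : Type*} [TopologicalSpace N] {ι : M → N} {O : N}
    {f : M → ℝ} {f' : N → ℝ} (hf : IsContinuousExtensionOf ι O f f') :
    Tendsto f (comap ι (𝓝 O)) (𝓝 (f' O)) :=
  (tendsto_comap_of_continuousWithinAt (hf.1 O (mem_union_right _ rfl))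
    (Eventually.of_forall fun x => mem_union_left _ (mem_range_self x))).congr hf.2

theorem IsContinuousExtensionOf.add {M N : Type*} [TopologicalSpace N] {ι : M → N} {O : N}
    {f h : M → ℝ} {f' h' : N → ℝ} (hf : IsContinuousExtensionOf ι O f f')
    (hh : IsContinuousExtensionOf ι O h h') : IsContinuousExtensionOf ι O (f + h) (f' + h') :=
  ⟨hf.1.add hh.1, fun x => congrArg₂ (· + ·) (hf.2 x) (hh.2 x)⟩

theorem IsContinuousExtensionOf.const_smul {M N : Type*} [TopologicalSpace N] {ι : M → N} {O : N}
    {f : M → ℝ} {f' : N → ℝ} (hf : IsContinuousExtensionOf ι O f f') (a : ℝ) :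
    IsContinuousExtensionOf ι O (a • f) (a • f') :=
  ⟨hf.1.const_smul a, fun x => congrArg (a • ·) (hf.2 x)⟩

variable {n : ℕ} {M N : Type*} [TopologicalSpace M] [ChartedSpace (Model n) M]
  [TopologicalSpace N] [ChartedSpace (Model n) N]
  {ι : M → N} {e : OpenPartialHomeomorph N (Model n)} {O : N}

/-- The components, in coordinates `e` on `N`, of the image under `dι` of a tangent vector of `M`.
-/
def pushforwardComp (ι : M → N) (e : OpenPartialHomeomorph N (Model n)) (x : M)
    (v : TangentSpace (𝓡 (n + 1)) x) : Fin (n + 1) → ℝ :=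
  coordForm e (ι x) (mfderiv (𝓡 (n + 1)) (𝓡 (n + 1)) ι x v)

variable [IsManifold (𝓡 (n + 1)) ∞ M] [IsManifold (𝓡 (n + 1)) ∞ N]
  {S : Spacetime n ∞ M} {S' : Spacetime n 0 N}

theorem IsContinuousExtension.mfderiv_surjective (hext : IsContinuousExtension S S' ι) (x : M) :
    Function.Surjective (mfderiv (𝓡 (n + 1)) (𝓡 (n + 1)) ι x) := by
  have hinj : Function.Injective (mfderiv (𝓡 (n + 1)) (𝓡 (n + 1)) ι x) :=
    (injective_iff_map_eq_zero _).2 fun v hv => (S.isLorentzian x).nondegenerate.1 v fun w => by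
      rw [← hext.isometric, hv, map_zero, LinearMap.zero_apply]
  let D : Model n →ₗ[ℝ] Model n := (mfderiv (𝓡 (n + 1)) (𝓡 (n + 1)) ι x).toLinearMap
  exact (LinearMap.injective_iff_surjective (f := D)).1 hinj

theorem IsContinuousExtension.pushforwardComp_surjective (hext : IsContinuousExtension S S' ι)
    (he : e.MDifferentiable (𝓡 (n + 1)) (𝓡 (n + 1))) {x : M} (hx : ι x ∈ e.source) :
    Function.Surjective (pushforwardComp ι e x) :=
  (coordEquiv he hx).surjective.comp (hext.mfderiv_surjective x)

theorem IsContinuousExtension.metric_eq (hext : IsContinuousExtension S S' ι)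
    (he : e.MDifferentiable (𝓡 (n + 1)) (𝓡 (n + 1))) {x : M} (hx : ι x ∈ e.source)
    (v w : TangentSpace (𝓡 (n + 1)) x) :
    S.metric x v w = (pushforwardComp ι e x v ᵥ* metricComp S'.metric e (e (ι x))) ⬝ᵥ
      pushforwardComp ι e x w := by
  rw [← hext.isometric, apply_eq_vecMul_metricComp_dotProduct he S'.metric hx]
  rfl

theorem IsContinuousExtension.of_eq_fluidMatrix (hext : IsContinuousExtension S S' ι)
    (he : e.MDifferentiable (𝓡 (n + 1)) (𝓡 (n + 1))) {x : M} (hx : ι x ∈ e.source)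
    {u : TangentSpace (𝓡 (n + 1)) x} {c μ : ℝ} {F : Fin (n + 1) → Fin (n + 1) → ℝ}
    (hF : ∀ v w : TangentSpace (𝓡 (n + 1)) x,
      ∑ i, ∑ j, F i j * pushforwardComp ι e x v i * pushforwardComp ι e x w j =
        c * S.metric x v w + μ * (S.metric x u v * S.metric x u w)) :
    Matrix.of F = fluidMatrix (metricComp S'.metric e (e (ι x))) (pushforwardComp ι e x u) c μ := by
  ext i j
  obtain ⟨v, hv⟩ := hext.pushforwardComp_surjective he hx (Pi.single i 1)
  obtain ⟨w, hw⟩ := hext.pushforwardComp_surjective he hx (Pi.single j 1)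
  have hFij := hF v w
  rw [hext.metric_eq he hx, hext.metric_eq he hx, hext.metric_eq he hx, hv, hw] at hFij
  simpa [Pi.single_apply, fluidMatrix, vecMulVec_apply] using hFij

theorem IsContinuousExtension.exists_chart_tendsto_vecMulVec (hext : IsContinuousExtension S S' ι)
    (hO : O ∈ closure (range ι)) {u : ∀ x : M, TangentSpace (𝓡 (n + 1)) x}
    (hu : ∀ x, S.metric x (u x) (u x) = -1)
    {T : ∀ x : M, TangentSpace (𝓡 (n + 1)) x → TangentSpace (𝓡 (n + 1)) x → ℝ} {c μ : M → ℝ}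
    (hT : ∀ x v w, T x v w =
      c x * S.metric x v w + μ x * (S.metric x (u x) v * S.metric x (u x) w))
    (hText : TensorExtendsContinuously ι O T) {μ' : N → ℝ}
    (hμ : IsContinuousExtensionOf ι O μ μ') (hμ₀ : μ' O ≠ 0) :
    ∃ e ∈ IsManifold.maximalAtlas (𝓡 (n + 1)) ∞ N, O ∈ e.source ∧ ∃ W ≠ 0,
      Tendsto (fun x => vecMulVec (pushforwardComp ι e x (u x)) (pushforwardComp ι e x (u x)))
        (comap ι (𝓝 O)) (𝓝 W) := by
  obtain ⟨e, he, hOe, F, hFc, hF⟩ := hText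
  have hed := mdifferentiable_of_mem_maximalAtlas he
  have hl : (comap ι (𝓝 O)).NeBot :=
    comap_neBot_iff_frequently.2 (mem_closure_iff_frequently.1 hO)
  have hsrc : ∀ᶠ x in comap ι (𝓝 O), ι x ∈ e.source :=
    tendsto_comap.eventually (e.open_source.mem_nhds hOe)
  have hA := (S'.continuousAt_metricComp he hOe).tendsto.comp (tendsto_comap (f := ι))
  have hunit : ∀ᶠ x in comap ι (𝓝 O), (pushforwardComp ι e x (u x) ᵥ*
      metricComp S'.metric e (e (ι x))) ⬝ᵥ pushforwardComp ι e x (u x) = -1 := by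
    filter_upwards [hsrc] with x hx
    rw [← hext.metric_eq hed hx, hu]
  have hFt : Tendsto (fun x => Matrix.of fun i j => F i j (ι x)) (comap ι (𝓝 O))
      (𝓝 (Matrix.of fun i j => F i j O)) :=
    tendsto_pi_nhds.2 fun i => tendsto_pi_nhds.2 fun j =>
      tendsto_comap_of_continuousWithinAt (hFc i j O (mem_union_right _ rfl))
        (hsrc.mono fun x hx => mem_union_left _ ⟨hx, mem_range_self x⟩)
  obtain ⟨W, hW⟩ := exists_tendsto_vecMulVec_of_fluidMatrix hA
    (hsrc.mono fun x hx => S'.isUnit_det_metricComp hed hx) (S'.isUnit_det_metricComp hed hOe)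
    hunit hμ.tendsto hμ₀ (hFt.congr' (hsrc.mono fun x hx =>
      hext.of_eq_fluidMatrix hed hx fun v w => (hF x hx v w).symm.trans (hT x v w)))
  refine ⟨e, he, hOe, W, ?_, hW⟩
  rintro rfl
  simpa using trace_mul_eq_of_tendsto_vecMulVec hA hunit hW

end Extension

section IntegralCurves

variable {n : ℕ} {N : Type*} [TopologicalSpace N] [ChartedSpace (Model n) N]
  {M : Type*} [TopologicalSpace M] [ChartedSpace (Model n) M] {ι : M → N} {O : N}
  {e : OpenPartialHomeomorph N (Model n)} {u : ∀ x : M, TangentSpace (𝓡 (n + 1)) x}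

theorem hasDerivAt_coord_integralCurve (hι : MDifferentiable (𝓡 (n + 1)) (𝓡 (n + 1)) ι)
    (he : e.MDifferentiable (𝓡 (n + 1)) (𝓡 (n + 1))) {d : ℝ → M} {t : ℝ}
    (ht : ι (d t) ∈ e.source) (hd : IsMIntegralCurveAt d u t) (i : Fin (n + 1)) :
    HasDerivAt (fun s => e (ι (d s)) i) (pushforwardComp ι e (d t) (u (d t)) i) t := by
  let Dι : Model n →L[ℝ] Model n := mfderiv (𝓡 (n + 1)) (𝓡 (n + 1)) ι (d t)
  let De : Model n →L[ℝ] Model n := mfderiv (𝓡 (n + 1)) (𝓡 (n + 1)) e (ι (d t))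
  have hcoord : HasFDerivAt (fun s => e (ι (d s)))
      (De.comp (Dι.comp ((1 : ℝ →L[ℝ] ℝ).smulRight (u (d t) : Model n)))) t :=
    ((he.mdifferentiableAt ht).hasMFDerivAt.comp t
      ((hι (d t)).hasMFDerivAt.comp t hd.hasMFDerivAt)).hasFDerivAt
  have hvelocity : De (Dι ((1 : ℝ →L[ℝ] ℝ).smulRight (u (d t) : Model n) 1)) = De (Dι (u (d t))) :=
    congrArg (fun v => De (Dι v)) (one_smul ℝ (u (d t) : Model n))
  have hproj := (EuclideanSpace.proj (𝕜 := ℝ) i).hasFDerivAt.comp_hasDerivAt t hcoord.hasDerivAt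
  exact hproj.congr_deriv (congrArg (EuclideanSpace.proj (𝕜 := ℝ) i) hvelocity)

theorem exists_parallel_of_integralCurve (hι : MDifferentiable (𝓡 (n + 1)) (𝓡 (n + 1)) ι)
    (he : e.MDifferentiable (𝓡 (n + 1)) (𝓡 (n + 1))) {d : ℝ → M} {γ : ℝ → N} {a b : ℝ}
    (hab : a < b) (hγ : ContinuousOn γ (Icc a b)) (hγe : MapsTo γ (Icc a b) e.source)
    (hd : IsMIntegralCurveOn d u (Ioc a b)) (hγd : ∀ t ∈ Ioc a b, γ t = ι (d t))
    (i j : Fin (n + 1)) :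
    ∃ t ∈ Ioo a b, (e (γ b) j - e (γ a) j) * pushforwardComp ι e (d t) (u (d t)) i
      = (e (γ b) i - e (γ a) i) * pushforwardComp ι e (d t) (u (d t)) j := by
  have hcont : ∀ i, ContinuousOn (fun t => e (γ t) i) (Icc a b) := fun i =>
    (EuclideanSpace.proj (𝕜 := ℝ) i).continuous.comp_continuousOn (e.continuousOn.comp hγ hγe)
  have hder : ∀ i, ∀ t ∈ Ioo a b,
      HasDerivAt (fun t => e (γ t) i) (pushforwardComp ι e (d t) (u (d t)) i) t := fun i t ht => by
    have hnhds : Ioc a b ∈ 𝓝 t := Ioc_mem_nhds ht.1 ht.2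
    have htd : ι (d t) ∈ e.source := hγd t (Ioo_subset_Ioc_self ht) ▸ hγe (Ioo_subset_Icc_self ht)
    refine (hasDerivAt_coord_integralCurve hι he htd
      (hd.isMIntegralCurveAt hnhds) i).congr_of_eventuallyEq ?_
    filter_upwards [hnhds] with s hs
    rw [hγd s hs]
  exact exists_ratio_hasDerivAt_eq_ratio_slope _ _ hab (hcont i) (hder i) _ _ (hcont j) (hder j)

variable [IsManifold (𝓡 (n + 1)) ∞ M] [IsManifold (𝓡 (n + 1)) ∞ N] {S' : Spacetime n 0 N}

theorem IntegralCurvesHavePastEndpoint.exists_integralCurve_to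
    (hb : IntegralCurvesHavePastEndpoint S' ι u O) {x : M}
    (hu : ContMDiffAt (𝓡 (n + 1)) (𝓡 (n + 1)).tangent 1
      (fun x => (⟨x, u x⟩ : TangentBundle (𝓡 (n + 1)) M)) x) :
    ∃ (d : ℝ → M) (γ : ℝ → N) (a b : ℝ), IsMIntegralCurveOn d u (Ioc a b) ∧
      (∀ t ∈ Ioc a b, γ t = ι (d t)) ∧ S'.IsTimelikeCurve γ a b ∧ γ a = O ∧ γ b = ι x := by
  obtain ⟨c, hc0, hc⟩ := exists_isMIntegralCurveAt_of_contMDiffAt_boundaryless (t₀ := 0) hu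
  obtain ⟨ε, hε, hcε⟩ := isMIntegralCurveAt_iff'.1 hc
  have hsub : Ioc (-(ε / 2)) 0 ⊆ Metric.ball (0 : ℝ) ε := fun t ht => by
    rw [Metric.mem_ball, Real.dist_eq, sub_zero, abs_lt]
    exact ⟨by linarith [ht.1], by linarith [ht.2]⟩
  have hneg : -(ε / 2) < 0 := by linarith
  obtain ⟨d, a, haε, hdc, hd, γ, hγa, hγd, hγ⟩ := hb c (-(ε / 2)) 0 hneg (hcε.mono hsub)
  refine ⟨d, γ, a, 0, hd, hγd, hγ, hγa, ?_⟩
  rw [hγd 0 ⟨haε.trans_lt hneg, le_rfl⟩, hdc ⟨hneg, le_rfl⟩, hc0]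

theorem Spacetime.frequently_mem_timelikeFuture {k : WithTop ℕ∞} {S : Spacetime n k N} {x : N}
    (he : e ∈ IsManifold.maximalAtlas (𝓡 (n + 1)) ∞ N) (hx : x ∈ e.source)
    {v : TangentSpace (𝓡 (n + 1)) x} (hv : S.IsFutureTimelike x v) :
    ∃ᶠ y in 𝓝 x, y ∈ S.timelikeFuture x ∧
      ∃ s : ℝ, 0 < s ∧ e y - e x = s • WithLp.toLp 2 (coordForm e x v) := by
  have htendsto : Tendsto (coordLine e x v) (𝓝[>] 0) (𝓝 x) := by
    have h := (contMDiffAt_coordLine (v := v) he hx).continuousAt.tendsto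
    rw [coordLine_zero hx] at h
    exact h.mono_left nhdsWithin_le_nhds
  refine htendsto.frequently (Eventually.frequently ?_)
  filter_upwards [eventually_isTimelikeCurve_coordLine he hx hv, self_mem_nhdsWithin,
    (eventually_apply_coordLine hx).filter_mono nhdsWithin_le_nhds] with s hs hs₀ hes
  exact ⟨⟨_, 0, s, hs, coordLine_zero hx, rfl⟩, s, hs₀, hes⟩

theorem Spacetime.mem_closure_timelikeFuture {k : WithTop ℕ∞} (S : Spacetime n k N) (x : N) :
    x ∈ closure (S.timelikeFuture x) := by
  refine mem_closure_iff_frequently.2 ((Spacetime.frequently_mem_timelikeFuture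
    (IsManifold.chart_mem_maximalAtlas x) (mem_chart_source _ x)
    (S.eventually_isFutureTimelike x).self_of_nhds).mono fun y hy => hy.1)

theorem frequently_parallel (hι : MDifferentiable (𝓡 (n + 1)) (𝓡 (n + 1)) ι)
    (hM : S'.timelikeFuture O ⊆ range ι)
    (hu : ContMDiff (𝓡 (n + 1)) (𝓡 (n + 1)).tangent 1
      fun x => (⟨x, u x⟩ : TangentBundle (𝓡 (n + 1)) M))
    (hb : IntegralCurvesHavePastEndpoint S' ι u O) (hd : S'.IsStronglyCausalAt O)
    (he : e ∈ IsManifold.maximalAtlas (𝓡 (n + 1)) ∞ N) (hO : O ∈ e.source)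
    {v : TangentSpace (𝓡 (n + 1)) O} (hv : S'.IsFutureTimelike O v) (i j : Fin (n + 1)) :
    ∃ᶠ x in comap ι (𝓝 O), coordForm e O v j * pushforwardComp ι e x (u x) i =
      coordForm e O v i * pushforwardComp ι e x (u x) j := by
  refine frequently_comap.2 (frequently_iff.2 fun {U} hU => ?_)
  obtain ⟨V, hV, -, hVU⟩ := hd (U ∩ e.source) (inter_mem hU (e.open_source.mem_nhds hO))
  obtain ⟨_, ⟨hy, s, hs, hes⟩, hyV⟩ :=
    ((Spacetime.frequently_mem_timelikeFuture he hO hv).and_eventually hV).exists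
  obtain ⟨x, rfl⟩ := hM hy
  obtain ⟨d, γ, a, b, hdu, hγd, hγ, hγa, hγb⟩ := hb.exists_integralCurve_to hu.contMDiffAt (x := x)
  have hγU : ∀ t ∈ Icc a b, γ t ∈ U ∩ e.source :=
    hVU γ a b hγ.1 (hγa ▸ mem_of_mem_nhds hV) (hγb ▸ hyV)
  obtain ⟨t, ht, hparallel⟩ := exists_parallel_of_integralCurve hι
    (mdifferentiable_of_mem_maximalAtlas he) hγ.1.1 hγ.1.2.1.1 (fun t ht => (hγU t ht).2) hdu hγd
    i j
  have hslope (k : Fin (n + 1)) : e (γ b) k - e (γ a) k = s * coordForm e O v k := by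
    rw [hγa, hγb, ← PiLp.sub_apply, hes, PiLp.smul_apply, smul_eq_mul]
  refine ⟨γ t, (hγU t (Ioo_subset_Icc_self ht)).1, d t, (hγd t (Ioo_subset_Ioc_self ht)).symm,
    mul_left_cancel₀ hs.ne' ?_⟩
  rw [← mul_assoc, ← mul_assoc, ← hslope, ← hslope, hparallel]

end IntegralCurves

theorem Spacetime.SolvesEinsteinPerfectFluid.ricci_eq {n : ℕ} {k : WithTop ℕ∞} {M : Type*}
    [TopologicalSpace M] [ChartedSpace (Model n) M] [IsManifold (𝓡 (n + 1)) ∞ M]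
    {S : Spacetime n k M} {u : ∀ x : M, TangentSpace (𝓡 (n + 1)) x} {ρ p : M → ℝ}
    (h : S.SolvesEinsteinPerfectFluid u ρ p) (x : M) (v w : TangentSpace (𝓡 (n + 1)) x) :
    ricci S.metric x v w =
      (8 * Real.pi * p x + scalarCurvature S.metric x / 2) * S.metric x v w +
        ((8 * Real.pi) • (ρ + p)) x * (S.metric x (u x) v * S.metric x (u x) w) := by
  simp only [Pi.smul_apply, Pi.add_apply, smul_eq_mul]
  linear_combination h.einstein x v w

end Spacetimes

end

theorem theorem2p2_general (n : ℕ) (hn : 1 ≤ n)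
    {M : Type*} [TopologicalSpace M]
    [ChartedSpace (EuclideanSpace ℝ (Fin (n + 1))) M] [IsManifold (𝓡 (n + 1)) ∞ M]
    {Mext : Type*} [TopologicalSpace Mext]
    [ChartedSpace (EuclideanSpace ℝ (Fin (n + 1))) Mext] [IsManifold (𝓡 (n + 1)) ∞ Mext]
    (S : Spacetimes.Spacetime n ∞ M) (Sext : Spacetimes.Spacetime n 0 Mext)
    (ι : M → Mext) (hext : Spacetimes.IsContinuousExtension S Sext ι)
    (O : Mext) (hM : Sext.timelikeFuture O ⊆ range ι)
    (u : ∀ x : M, TangentSpace (𝓡 (n + 1)) x)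
    (hu : ContMDiff (𝓡 (n + 1)) (𝓡 (n + 1)).tangent 1
      fun x => (⟨x, u x⟩ : TangentBundle (𝓡 (n + 1)) M))
    (hunit : ∀ x, S.metric x (u x) (u x) = -1)
    (T : ∀ x : M, TangentSpace (𝓡 (n + 1)) x → TangentSpace (𝓡 (n + 1)) x → ℝ) (c μ : M → ℝ)
    (hT : ∀ x v w, T x v w =
      c x * S.metric x v w + μ x * (S.metric x (u x) v * S.metric x (u x) w))
    (hb : Spacetimes.IntegralCurvesHavePastEndpoint Sext ι u O)
    (hText : Spacetimes.TensorExtendsContinuously ι O T)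
    (μ' : Mext → ℝ) (hμ : Spacetimes.IsContinuousExtensionOf ι O μ μ')
    (hd : Sext.IsStronglyCausalAt O) :
    μ' O = 0 := by
  by_contra hμ₀
  have : Nontrivial (Fin (n + 1)) := Fin.nontrivial_iff_two_le.2 (by omega)
  have hι : MDifferentiable (𝓡 (n + 1)) (𝓡 (n + 1)) ι :=
    hext.isSmoothEmbedding.contMDiff.mdifferentiable (by simp)
  have hO : O ∈ closure (range ι) := closure_mono hM (Sext.mem_closure_timelikeFuture O)
  obtain ⟨e, he, hOe, W, hW₀, hW⟩ :=
    hext.exists_chart_tendsto_vecMulVec hO hunit hT hText hμ hμ₀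
  have hparallel : ∀ᶠ v in 𝓝 (Sext.timeField O), ∀ m i j,
      Spacetimes.coordForm e O v j * W i m = Spacetimes.coordForm e O v i * W j m :=
    (Sext.eventually_isFutureTimelike O).mono fun v hv m i j =>
      Spacetimes.mul_apply_eq_of_frequently_of_tendsto_vecMulVec
        (Spacetimes.frequently_parallel hι hM hu hb hd he hOe hv i j) hW m
  have hcolumn (m : Fin (n + 1)) : (fun i => W i m) = 0 :=
    Spacetimes.eq_zero_of_eventually_parallel (Spacetimes.eventually_nhds_coordForm
      (Spacetimes.mdifferentiable_of_mem_maximalAtlas he) hOe (hparallel.mono fun v hv => hv m))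
  exact hW₀ (Matrix.ext fun i m => congrFun (hcolumn m) i)

theorem theorem2p2 (n : ℕ) (hn : 1 ≤ n)
    {M : Type*} [TopologicalSpace M] [T2Space M] [SecondCountableTopology M]
    [ChartedSpace (EuclideanSpace ℝ (Fin (n + 1))) M] [IsManifold (𝓡 (n + 1)) ∞ M]
    {Mext : Type*} [TopologicalSpace Mext] [T2Space Mext] [SecondCountableTopology Mext]
    [ChartedSpace (EuclideanSpace ℝ (Fin (n + 1))) Mext] [IsManifold (𝓡 (n + 1)) ∞ Mext]
    (S : Spacetimes.Spacetime n ∞ M) (Sext : Spacetimes.Spacetime n 0 Mext)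
    (ι : M → Mext) (hext : Spacetimes.IsContinuousExtension S Sext ι)
    (O : Mext) (hO : O ∈ Sext.pastBoundary (range ι))
    (hM : range ι = Sext.timelikeFuture O)
    (u : ∀ x : M, TangentSpace (𝓡 (n + 1)) x) (ρ p : M → ℝ)
    (ha : S.SolvesEinsteinPerfectFluid u ρ p)
    (hb : Spacetimes.IntegralCurvesHavePastEndpoint Sext ι u O)
    (hRic : Spacetimes.TensorExtendsContinuously ι O (Spacetimes.ricci S.metric))
    (ρ' p' : Mext → ℝ)
    (hρ : Spacetimes.IsContinuousExtensionOf ι O ρ ρ')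
    (hp : Spacetimes.IsContinuousExtensionOf ι O p p')
    (hd : Sext.IsStronglyCausalAt O) :
    ρ' O = -p' O := by
  have hμ : 8 * Real.pi * (ρ' O + p' O) = 0 := theorem2p2_general n hn S Sext ι hext O hM.ge u
    (ha.contMDiff_u.of_le (by simp)) ha.unit _ _ _ ha.ricci_eq hb hRic _
    ((hρ.add hp).const_smul _) hd
  exact eq_neg_of_add_eq_zero_left ((mul_eq_zero.1 hμ).resolve_left (by positivity))
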